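/- For a closed set $E\subset\mathbb{R}^3$ and $\rho>0$, let the $\rho$-hulloid $\mathrm{co}_\rho(E)$ be the intersection of the complements of all open balls of radius $\rho$ that do not meet $E$. Let $V=\{v_1,v_2,v_3,v_4\}$ be the set of vertices of a (non-degenerate) tetrahedron $T=\mathrm{co}(V)\subset\mathbb{R}^3$ with circumradius $r(V)$, and let $$R^*=r_L(V)=\inf\{\rho>r(V): \mathrm{int}(\mathrm{co}_\rho(V))\neq\emptyset\}\ \ (\ge r(V)).$$ For every $\rho>r(V)$ and $1\le i\le 4$ there is a unique point $o_i(\rho)$ such that the sphere $\partial B(o_i(\rho),\rho)$ contains $V\setminus\{v_i\}$ and $v_i\notin B(o_i(\rho),\rho)$; write $B_i(\rho)=B(o_i(\rho),\rho)$ for this open ball. Then: 1. $\mathrm{co}_\rho(V)=V$ for $0<\rho<R^*$. 2. For $\rho>R^*$, $\mathrm{co}_\rho(V)=V\cup\tilde\Gamma$ with $\tilde\Gamma=\mathrm{int}(T)\setminus\bigcup_{i=1}^4 B_i(\rho)$. The set $\tilde\Gamma$ is nonempty and connected, and $\partial\tilde\Gamma=S_1\cup S_2\cup S_3\cup S_4$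 with each $S_i$ a nonempty connected subset of $\partial B_i(\rho)$. 3. For $\rho=R^*$: if $r_L(V)>r(V)$, then the four spheres $\partial B_i(R^*)$ intersect in exactly one point $O^*$, this point lies in $\mathrm{int}(T)$, and $\mathrm{co}_{R^*}(V)=V\cup\{O^*\}$; if $r_L(V)=r(V)$, then $\mathrm{co}_{R^*}(V)=V$. -/

import Mathlib

open Metric Set

/-- Euclidean three-space. -/
abbrev E3 : Type := EuclideanSpace ℝ (Fin 3)

/-- The `R`-hulloid of `E`: the intersection of the complements of all open balls of radius `R`
that do not meet `E` (the whole space if there is no such ball). -/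
def hulloid (R : ℝ) (E : Set E3) : Set E3 :=
  ⋂ (x : E3) (_ : ball x R ∩ E = ∅), (ball x R)ᶜ

/-- The set `V` of vertices of a tetrahedron. -/
def vertexSet (T : Affine.Simplex ℝ E3 3) : Set E3 := range T.points

/-- The solid tetrahedron `co(V)`. -/
def solid (T : Affine.Simplex ℝ E3 3) : Set E3 := convexHull ℝ (vertexSet T)

/-- A hulloid is full if it has nonempty interior. -/
def IsFull (T : Affine.Simplex ℝ E3 3) (ρ : ℝ) : Prop :=
  (interior (hulloid ρ (vertexSet T))).Nonempty

/-- `r_L(V) = inf {ρ > r(V) : co_ρ(V) is full}`, with `r(V)` the circumradius. -/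
noncomputable def criticalRadius (T : Affine.Simplex ℝ E3 3) : ℝ :=
  sInf {ρ : ℝ | T.circumradius < ρ ∧ IsFull T ρ}

/-- `p` is a centre of a sphere of radius `ρ` through the three vertices other than the `i`-th,
such that the open ball does not contain the `i`-th vertex. -/
def IsFaceCenter (T : Affine.Simplex ℝ E3 3) (i : Fin 4) (ρ : ℝ) (p : E3) : Prop :=
  (∀ j, j ≠ i → T.points j ∈ sphere p ρ) ∧ T.points i ∉ ball p ρ

/-- The set `int(T) \ ⋃ B(o_i, ρ)`. -/
def innerPart (T : Affine.Simplex ℝ E3 3) (o : Fin 4 → E3) (ρ : ℝ) : Set E3 :=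
  interior (solid T) \ ⋃ i, ball (o i) ρ

/-! Let `D` be minus the power with respect to the circumsphere and `β i` the barycentric
coordinates; then `D x = ∑ β i x * ‖v i - x‖ ^ 2`. A ball with vertex powers `a i` is the set where
`∑ a i * β i < D`, and its squared radius is a convex quadratic function of `a`. The `i`-th facet
ball has the single nonzero vertex power `k i`, so convexity shows that a point of the circumball
outside all the facet balls lies outside every ball of radius `ρ` missing the vertices: besides the
vertices, the hull consists of the core `{0 < D, ∀ i, D ≤ k i * β i}`.

The radical centre `z` of the facet spheres has `β i z` proportional to `1 / k i`. Every point `x`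
of the core satisfies `‖z - x‖ ^ 2 ≤ P`, where `P` is the common power of `z`, so the core is empty,
the single point `z`, or a set with interior points according to the sign of `P`. Since the `k i`
increase continuously with `ρ`, `P` is negative between the circumradius and the critical radius and
positive beyond it, and it vanishes at the critical radius if this exceeds the circumradius.

In the coordinates `ν i = β i / D - 1 / k i` the core is a level set in the nonnegative orthant of a
quadratic form with nonnegative coefficients plus a linear form. A ray from the origin meets this
set at most once, and the rays that meet it form a convex set, so the core is connected. The same
argument on the face `ν i = 0` shows that its part on the `i`-th facet sphere is connected. -/

open scoped RealInnerProductSpace Topology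

section Connectedness

lemma nonempty_inter_frontier_of_isPreconnected {α : Type*} [TopologicalSpace α] {s A : Set α}
    (hs : IsPreconnected s) (hA : (s ∩ A).Nonempty) (hAc : (s \ A).Nonempty) :
    (s ∩ frontier A).Nonempty := by
  have := Subtype.preconnectedSpace hs
  obtain ⟨x, hxs, hxA⟩ := hA
  obtain ⟨y, hys, hyA⟩ := hAc
  obtain ⟨z, hz⟩ : (frontier (Subtype.val ⁻¹' A : Set s)).Nonempty :=
    nonempty_frontier_iff.2 ⟨⟨⟨x, hxs⟩, hxA⟩, (ne_univ_iff_exists_notMem _).2 ⟨⟨y, hys⟩, hyA⟩⟩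
  exact ⟨z, z.2, continuous_subtype_val.frontier_preimage_subset A hz⟩

variable {V : Type*} [AddCommGroup V] [Module ℝ V] {K : ConvexCone ℝ V} {Q b : V → ℝ}

lemma convex_setOf_pos_or_pos_of_superadditive
    (hQ_smul : ∀ t > 0, ∀ v, Q (t • v) = t ^ 2 * Q v)
    (hb_smul : ∀ t > 0, ∀ v, b (t • v) = t * b v)
    (hQ_add : ∀ v ∈ K, ∀ w ∈ K, Q v + Q w ≤ Q (v + w))
    (hb_add : ∀ v ∈ K, ∀ w ∈ K, b v + b w ≤ b (v + w)) (hQ : ∀ v ∈ K, 0 ≤ Q v) :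
    Convex ℝ {v | v ∈ K ∧ (0 < Q v ∨ 0 < b v)} := by
  refine convex_iff_forall_pos.2 fun v hv w hw s t hs ht _ => ?_
  obtain ⟨hvK, hv⟩ := hv
  obtain ⟨hwK, hw⟩ := hw
  have hsv := K.smul_mem hs hvK
  have htw := K.smul_mem ht hwK
  have hQvw := hQ_add _ hsv _ htw
  have hbvw := hb_add _ hsv _ htw
  rw [hQ_smul s hs, hQ_smul t ht] at hQvw
  rw [hb_smul s hs, hb_smul t ht] at hbvw
  have hsQ := mul_nonneg (sq_nonneg s) (hQ v hvK)
  have htQ := mul_nonneg (sq_nonneg t) (hQ w hwK)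
  refine ⟨K.add_mem hsv htw, ?_⟩
  rcases hv with hv | hv
  · exact Or.inl (by linarith [mul_pos (pow_pos hs 2) hv])
  rcases hw with hw | hw
  · exact Or.inl (by linarith [mul_pos (pow_pos ht 2) hw])
  · exact Or.inr (by linarith [mul_pos hs hv, mul_pos ht hw])

lemma pos_add_sqrt_discrim {q β C : ℝ} (hC : 0 < C) (hq : 0 ≤ q) (h : 0 < q ∨ 0 < β) :
    0 < β + √(β ^ 2 + 4 * q * C) := by
  rcases h with h | h
  · have : |β| < √(β ^ 2 + 4 * q * C) :=
      Real.lt_sqrt_of_sq_lt (by rw [sq_abs]; linarith [mul_pos h hC])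
    linarith [neg_abs_le β]
  · positivity

lemma quadratic_eq_of_eq_div {q β C : ℝ} (hC : 0 < C) (hq : 0 ≤ q) (h : 0 < q ∨ 0 < β) :
    (2 * C / (β + √(β ^ 2 + 4 * q * C))) ^ 2 * q + 2 * C / (β + √(β ^ 2 + 4 * q * C)) * β = C := by
  have hpos := pos_add_sqrt_discrim hC hq h
  have hsq : √(β ^ 2 + 4 * q * C) ^ 2 = β ^ 2 + 4 * q * C := Real.sq_sqrt (by positivity)
  set s := √(β ^ 2 + 4 * q * C)
  rw [div_pow, div_mul_eq_mul_div, div_mul_eq_mul_div, div_add_div _ _ (pow_ne_zero 2 hpos.ne')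
    hpos.ne', div_eq_iff (by positivity)]
  linear_combination -C * (β + s) * hsq

/-- Each ray of the cone that meets the level set meets it once, so the level set is a continuous
image of a convex set of rays. -/
theorem isConnected_levelSet_of_superadditive [TopologicalSpace V] [ContinuousAdd V]
    [ContinuousSMul ℝ V] (hQ_cont : Continuous Q) (hb_cont : Continuous b)
    (hQ_smul : ∀ t > 0, ∀ v, Q (t • v) = t ^ 2 * Q v)
    (hb_smul : ∀ t > 0, ∀ v, b (t • v) = t * b v)
    (hQ_add : ∀ v ∈ K, ∀ w ∈ K, Q v + Q w ≤ Q (v + w))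
    (hb_add : ∀ v ∈ K, ∀ w ∈ K, b v + b w ≤ b (v + w)) (hQ : ∀ v ∈ K, 0 ≤ Q v)
    (hpos : ∃ v ∈ K, 0 < Q v) {C : ℝ} (hC : 0 < C) :
    IsConnected {v | v ∈ K ∧ Q v + b v = C} := by
  set D := {v | v ∈ K ∧ (0 < Q v ∨ 0 < b v)}
  set scale := fun v => 2 * C / (b v + √(b v ^ 2 + 4 * Q v * C)) with hscale
  have hden : ∀ v ∈ D, 0 < b v + √(b v ^ 2 + 4 * Q v * C) := fun v hv =>
    pos_add_sqrt_discrim hC (hQ v hv.1) hv.2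
  have himage : {v | v ∈ K ∧ Q v + b v = C} = (fun v => scale v • v) '' D := by
    refine Subset.antisymm (fun v hv => ?_) ?_
    · have hvQ := hQ v hv.1
      have hsqrt : √(b v ^ 2 + 4 * Q v * C) = 2 * Q v + b v := by
        rw [Real.sqrt_eq_iff_mul_self_eq (by positivity) (by linarith [hv.2]), ← hv.2]
        ring
      have hone : scale v = 1 := by
        rw [hscale]
        simp only [hsqrt]
        rw [div_eq_one_iff_eq (by linarith [hv.2])]
        linarith [hv.2]
      refine ⟨v, ⟨hv.1, ?_⟩, by simp only [hone, one_smul]⟩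
      by_contra! h
      linarith [hv.2, h.1, h.2]
    · rintro _ ⟨v, hv, rfl⟩
      have ht : 0 < scale v := div_pos (by positivity) (hden v hv)
      refine ⟨K.smul_mem ht hv.1, ?_⟩
      rw [hQ_smul _ ht, hb_smul _ ht]
      exact quadratic_eq_of_eq_div hC (hQ v hv.1) hv.2
  have hD : IsConnected D := ⟨hpos.imp fun v hv => ⟨hv.1, Or.inl hv.2⟩,
    (convex_setOf_pos_or_pos_of_superadditive hQ_smul hb_smul hQ_add hb_add hQ).isPreconnected⟩
  rw [himage]
  refine hD.image _ (ContinuousOn.smul (continuousOn_const.div ?_ fun v hv => (hden v hv).ne')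
    continuousOn_id)
  fun_prop

end Connectedness

section BallHull

/-- The intersection of the complements of all open balls of radius `ρ` that do not meet `A`; in
Euclidean space this is the `ρ`-hulloid of `A`. -/
def ballHull {X : Type*} [PseudoMetricSpace X] (ρ : ℝ) (A : Set X) : Set X :=
  ⋂ (c : X) (_ : ball c ρ ∩ A = ∅), (ball c ρ)ᶜ

lemma mem_ballHull {X : Type*} [PseudoMetricSpace X] {ρ : ℝ} {A : Set X} {x : X} :
    x ∈ ballHull ρ A ↔ ∀ c, Disjoint (ball c ρ) A → x ∉ ball c ρ := by
  simp only [ballHull, disjoint_iff_inter_eq_empty, mem_iInter, mem_compl_iff]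

lemma subset_ballHull {X : Type*} [PseudoMetricSpace X] (ρ : ℝ) (A : Set X) : A ⊆ ballHull ρ A :=
  fun _ hx => mem_ballHull.2 fun _ hc hxc => hc.notMem_of_mem_left hxc hx

lemma disjoint_ball_iff {X : Type*} [PseudoMetricSpace X] {c : X} {ρ : ℝ} {A : Set X} :
    Disjoint (ball c ρ) A ↔ ∀ y ∈ A, ρ ≤ dist y c := by
  simp only [disjoint_right, mem_ball, not_lt]

variable {E : Type*} [NormedAddCommGroup E]

/-- A point of a ball of radius `ρ'` lies in some ball of radius `ρ ≤ ρ'` inside it. -/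
lemma ballHull_mono [NormedSpace ℝ E] {ρ ρ' : ℝ} (hρ : 0 < ρ) (h : ρ ≤ ρ') (A : Set E) :
    ballHull ρ A ⊆ ballHull ρ' A := by
  intro x hx
  rw [mem_ballHull] at hx ⊢
  intro c hc hxc
  have hρ' : 0 < ρ' := hρ.trans_le h
  set t := ρ / ρ' with ht
  have ht0 : 0 < t := div_pos hρ hρ'
  have ht1 : 0 ≤ 1 - t := sub_nonneg.2 ((div_le_one hρ').2 h)
  have htρ : t * ρ' = ρ := div_mul_cancel₀ _ hρ'.ne'
  rw [mem_ball] at hxc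
  have hsub : ball (AffineMap.lineMap x c t) ρ ⊆ ball c ρ' := by
    refine ball_subset_ball' ?_
    rw [dist_lineMap_right, Real.norm_of_nonneg ht1]
    linarith [mul_le_mul_of_nonneg_left hxc.le ht1]
  refine hx _ (hc.mono_left hsub) ?_
  rw [mem_ball', dist_lineMap_left, Real.norm_of_nonneg ht0.le]
  exact (mul_lt_mul_of_pos_left hxc ht0).trans_eq htρ

variable [InnerProductSpace ℝ E] {ρ r : ℝ} {A : Set E} {O x y : E}

lemma inner_sub_sub_nonpos_of_norm_le (h : ‖y - O‖ ≤ ‖x - O‖) : ⟪y - x, x - O⟫ ≤ 0 := by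
  have h1 : ⟪y - O, x - O⟫ ≤ ‖x - O‖ * ‖x - O‖ :=
    (real_inner_le_norm _ _).trans (mul_le_mul_of_nonneg_right h (norm_nonneg _))
  rw [← sub_sub_sub_cancel_right y x O, inner_sub_left, real_inner_self_eq_norm_mul_norm]
  linarith

/-- If `ball x ε` misses `A`, then moving the centre from `x` away from `O` by `√(ρ² - ε²)` gives a
ball of radius `ρ` around `x` that misses `A`. -/
lemma mem_ball_of_mem_ballHull (hA : IsClosed A) (hAO : A ⊆ closedBall O r) (hr : 0 < r)
    (hρ : 0 < ρ) (hx : x ∈ ballHull ρ A) (hxA : x ∉ A) : x ∈ ball O r := by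
  by_contra hxO
  obtain ⟨δ, hδ, hδA⟩ := Metric.isOpen_iff.1 hA.isOpen_compl x hxA
  set ε := min δ ρ
  have hε : 0 < ε := lt_min hδ hρ
  have hερ : ε ^ 2 ≤ ρ ^ 2 := pow_le_pow_left₀ hε.le (min_le_right _ _) 2
  rw [mem_ball, dist_eq_norm, not_lt] at hxO
  set D := ‖x - O‖ with hD
  have hD0 : 0 < D := hr.trans_le hxO
  set t := √(ρ ^ 2 - ε ^ 2)
  have ht : t ^ 2 = ρ ^ 2 - ε ^ 2 := Real.sq_sqrt (sub_nonneg.2 hερ)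
  have htD : 0 ≤ t / D := div_nonneg (Real.sqrt_nonneg _) hD0.le
  set u := (t / D) • (x - O) with hu
  have hnorm_u : ‖u‖ = t := by
    rw [hu, norm_smul, Real.norm_of_nonneg htD, ← hD, div_mul_cancel₀ _ hD0.ne']
  refine mem_ballHull.1 hx (x + u) (disjoint_ball_iff.2 fun y hy => ?_) ?_
  · have hyx : ε ^ 2 ≤ ‖y - x‖ ^ 2 := by
      refine pow_le_pow_left₀ hε.le ?_ 2
      rw [← dist_eq_norm]
      by_contra! hlt
      exact hδA (mem_ball.2 (hlt.trans_le (min_le_left _ _))) hy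
    have hyu : ⟪y - x, u⟫ ≤ 0 := by
      rw [hu, real_inner_smul_right]
      exact mul_nonpos_of_nonneg_of_nonpos htD
        (inner_sub_sub_nonpos_of_norm_le ((mem_closedBall_iff_norm.1 (hAO hy)).trans hxO))
    rw [dist_eq_norm, ← sub_sub]
    refine le_of_sq_le_sq ?_ (norm_nonneg _)
    rw [norm_sub_sq_real, hnorm_u]
    linarith
  · rw [mem_ball', dist_eq_norm, add_sub_cancel_left, hnorm_u]
    exact lt_of_pow_lt_pow_left₀ 2 hρ.le (by linarith [pow_pos hε 2])

theorem ballHull_eq_self_of_subset_sphere (hA : IsClosed A) (hAO : A ⊆ sphere O r) (hρ : 0 < ρ)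
    (hρr : ρ ≤ r) : ballHull ρ A = A := by
  refine Subset.antisymm (fun x hx => ?_) (subset_ballHull ρ A)
  by_contra hxA
  have hdisj : Disjoint (ball O r) A := sphere_disjoint_ball.symm.mono_right hAO
  have hr : 0 < r := hρ.trans_le hρr
  have hx' : x ∈ ballHull r A := ballHull_mono hρ hρr A hx
  exact mem_ballHull.1 hx' O hdisj
    (mem_ball_of_mem_ballHull hA (hAO.trans sphere_subset_closedBall) hr hr hx' hxA)

end BallHull

namespace SimplexHull

variable {E : Type*} [NormedAddCommGroup E] [InnerProductSpace ℝ E] {n : ℕ}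
  (T : Affine.Simplex ℝ E n) {ρ ρ' : ℝ} {x : E}

/-- `p` is the centre of a sphere of radius `ρ` through all vertices but the `i`-th, which is not in
the corresponding open ball. -/
def IsFacetCenter (i : Fin (n + 1)) (ρ : ℝ) (p : E) : Prop :=
  (∀ j, j ≠ i → T.points j ∈ sphere p ρ) ∧ T.points i ∉ ball p ρ

/-- The infimum of the radii above the circumradius for which the hull of the vertices has interior
points. -/
noncomputable def fullnessRadius : ℝ :=
  sInf {ρ | T.circumradius < ρ ∧ (interior (ballHull ρ (range T.points))).Nonempty}

section Depth

/-- Minus the power of a point with respect to the circumsphere of a simplex; it is positive inside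
the circumsphere. -/
noncomputable def depth (x : E) : ℝ := T.circumradius ^ 2 - ‖x - T.circumcenter‖ ^ 2

lemma continuous_depth : Continuous (depth T) := by
  unfold depth
  fun_prop

lemma norm_points_sub_circumcenter (i : Fin (n + 1)) :
    ‖T.points i - T.circumcenter‖ = T.circumradius := by
  rw [← dist_eq_norm, T.dist_circumcenter_eq_circumradius i]

lemma depth_points (i : Fin (n + 1)) : depth T (T.points i) = 0 := by
  rw [depth, norm_points_sub_circumcenter, sub_self]

lemma circumradius_pos [NeZero n] : 0 < T.circumradius := by
  obtain ⟨m, rfl⟩ := Nat.exists_eq_succ_of_ne_zero (NeZero.ne n)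
  exact T.circumradius_pos

variable {T} in
lemma sq_sub_sq_circumradius_pos (hρ : T.circumradius < ρ) : 0 < ρ ^ 2 - T.circumradius ^ 2 :=
  sub_pos.2 (pow_lt_pow_left₀ hρ T.circumradius_nonneg two_ne_zero)

theorem ballHull_eq_range_points (hρ : 0 < ρ) (h : ρ ≤ T.circumradius) :
    ballHull ρ (range T.points) = range T.points :=
  ballHull_eq_self_of_subset_sphere (finite_range T.points).isClosed
    (range_subset_iff.2 fun i => T.dist_circumcenter_eq_circumradius i) hρ h

end Depth

section DistForm

/-- The bilinear form of the halved squared distances of the vertices; on the barycentric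
coordinates of a point it gives the depth of the point. -/
noncomputable def distForm : LinearMap.BilinForm ℝ (Fin (n + 1) → ℝ) :=
  Matrix.toBilin' (Matrix.of fun i j => ‖T.points i - T.points j‖ ^ 2 / 2)

lemma distForm_apply (μ ν : Fin (n + 1) → ℝ) :
    distForm T μ ν = ∑ i, ∑ j, μ i * (‖T.points i - T.points j‖ ^ 2 / 2) * ν j :=
  Matrix.toBilin'_apply _ _ _

lemma distForm_comm (μ ν : Fin (n + 1) → ℝ) : distForm T μ ν = distForm T ν μ := by
  rw [distForm_apply, distForm_apply, Finset.sum_comm]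
  refine Finset.sum_congr rfl fun j _ => Finset.sum_congr rfl fun i _ => ?_
  rw [norm_sub_rev]
  ring

lemma distForm_add_self (μ ν : Fin (n + 1) → ℝ) :
    distForm T (μ + ν) (μ + ν) = distForm T μ μ + 2 * distForm T μ ν + distForm T ν ν := by
  simp only [map_add, LinearMap.add_apply, distForm_comm T ν μ]
  ring

lemma distForm_smul_self (t : ℝ) (μ : Fin (n + 1) → ℝ) :
    distForm T (t • μ) (t • μ) = t ^ 2 * distForm T μ μ := by
  simp only [map_smul, LinearMap.smul_apply, smul_eq_mul]
  ring

lemma continuous_distForm_self : Continuous fun μ => distForm T μ μ := by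
  simp only [distForm_apply]
  fun_prop

lemma distForm_nonneg {μ ν : Fin (n + 1) → ℝ} (hμ : 0 ≤ μ) (hν : 0 ≤ ν) : 0 ≤ distForm T μ ν := by
  rw [distForm_apply]
  exact Finset.sum_nonneg fun i _ => Finset.sum_nonneg fun j _ =>
    mul_nonneg (mul_nonneg (hμ i) (by positivity)) (hν j)

lemma distForm_single_add_single_pos {j k : Fin (n + 1)} (h : j ≠ k) :
    0 < distForm T (Pi.single j 1 + Pi.single k 1) (Pi.single j 1 + Pi.single k 1) := by
  have hjk : 0 < ‖T.points j - T.points k‖ :=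
    norm_pos_iff.2 (sub_ne_zero.2 (T.independent.injective.ne h))
  have hsingle (i l : Fin (n + 1)) : distForm T (Pi.single i 1) (Pi.single l 1) =
      ‖T.points i - T.points l‖ ^ 2 / 2 := Matrix.toBilin'_single _ _ _
  rw [distForm_add_self, hsingle, hsingle, hsingle, sub_self, sub_self, norm_zero]
  linarith [pow_pos hjk 2]

end DistForm

variable [FiniteDimensional ℝ E] [Fact (Module.finrank ℝ E = n)]

section Barycentric

/-- The vertices of a full-dimensional simplex as an affine basis. -/
noncomputable def vertexBasis : AffineBasis (Fin (n + 1)) ℝ E where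
  toFun := T.points
  ind' := T.independent
  tot' := T.independent.affineSpan_eq_top_iff_card_eq_finrank_add_one.2 <| by
    rw [Fintype.card_fin, Fact.out (p := Module.finrank ℝ E = n)]

/-- The `i`-th barycentric coordinate. -/
noncomputable def bary (i : Fin (n + 1)) : E →ᵃ[ℝ] ℝ := (vertexBasis T).coord i

/-- The gradient of the `i`-th barycentric coordinate. -/
noncomputable def baryGrad (i : Fin (n + 1)) : E :=
  (InnerProductSpace.toDual ℝ E).symm (LinearMap.toContinuousLinearMap (bary T i).linear)

lemma continuous_bary (i : Fin (n + 1)) : Continuous (bary T i) :=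
  (bary T i).continuous_of_finiteDimensional

lemma bary_eq_add_inner (i : Fin (n + 1)) (x y : E) :
    bary T i y = bary T i x + ⟪baryGrad T i, y - x⟫ := by
  have h := (bary T i).map_vadd x (y - x)
  rw [vadd_eq_add, sub_add_cancel, vadd_eq_add] at h
  rw [h, baryGrad, InnerProductSpace.toDual_symm_apply, LinearMap.coe_toContinuousLinearMap',
    add_comm]

lemma sum_bary (x : E) : ∑ i, bary T i x = 1 := (vertexBasis T).sum_coord_apply_eq_one x

lemma sum_bary_smul_sub (x c : E) : ∑ i, bary T i x • (T.points i - c) = x - c := by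
  have hx : ∑ i, bary T i x • T.points i = x := (vertexBasis T).linear_combination_coord_eq_self x
  simp only [smul_sub, Finset.sum_sub_distrib, ← Finset.sum_smul, sum_bary, one_smul, hx]

lemma bary_points (i j : Fin (n + 1)) : bary T i (T.points j) = if i = j then 1 else 0 :=
  (vertexBasis T).coord_apply i j

lemma bary_points_self (i : Fin (n + 1)) : bary T i (T.points i) = 1 := by
  rw [bary_points, if_pos rfl]

lemma bary_points_of_ne {i j : Fin (n + 1)} (h : i ≠ j) : bary T i (T.points j) = 0 := by
  rw [bary_points, if_neg h]

lemma bary_ext {x y : E} (h : ∀ i, bary T i x = bary T i y) : x = y := (vertexBasis T).ext_elem h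

lemma mem_interior_convexHull_iff :
    x ∈ interior (convexHull ℝ (range T.points)) ↔ ∀ i, 0 < bary T i x :=
  Set.ext_iff.1 (vertexBasis T).interior_convexHull x

lemma baryGrad_ne_zero [NeZero n] (i : Fin (n + 1)) : baryGrad T i ≠ 0 := by
  intro h
  obtain ⟨j, hj⟩ := exists_ne i
  have := bary_eq_add_inner T i (T.points i) (T.points j)
  rw [h, inner_zero_left, bary_points_self, bary_points_of_ne T hj.symm] at this
  norm_num at this

lemma norm_baryGrad_pos [NeZero n] (i : Fin (n + 1)) : 0 < ‖baryGrad T i‖ :=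
  norm_pos_iff.2 (baryGrad_ne_zero T i)

lemma bary_centerMass {μ : Fin (n + 1) → ℝ} (hμ : ∑ i, μ i ≠ 0) (i : Fin (n + 1)) :
    bary T i (Finset.univ.centerMass μ T.points) = μ i / ∑ j, μ j := by
  have hone : ∑ i, μ i / ∑ j, μ j = 1 := by rw [← Finset.sum_div, div_self hμ]
  have hcomb : Finset.univ.centerMass μ T.points =
      Finset.univ.affineCombination ℝ (vertexBasis T) fun i => μ i / ∑ j, μ j := by
    rw [affineCombination_eq_centerMass hone, Finset.centerMass_eq_of_sum_1 _ _ hone,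
      Finset.centerMass, Finset.smul_sum]
    exact Finset.sum_congr rfl fun i _ => by rw [smul_smul, inv_mul_eq_div]; rfl
  rw [hcomb]
  exact (vertexBasis T).coord_apply_combination_of_mem (Finset.mem_univ i) hone

/-- The squared distance from `c` minus the power with respect to the circumsphere is affine, hence
determined by its values at the vertices. -/
lemma norm_sub_sq_eq (x c : E) :
    ‖x - c‖ ^ 2 = ∑ i, bary T i x * ‖T.points i - c‖ ^ 2 - depth T x := by
  set O := T.circumcenter with hO
  have hvertex (i : Fin (n + 1)) : ‖T.points i - c‖ ^ 2 =
      T.circumradius ^ 2 + ‖c - O‖ ^ 2 - 2 * ⟪T.points i - O, c - O⟫ := by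
    rw [← sub_sub_sub_cancel_right _ c O, norm_sub_sq_real, hO, norm_points_sub_circumcenter]
    ring
  have hinner : ∑ i, bary T i x * ⟪T.points i - O, c - O⟫ = ⟪x - O, c - O⟫ := by
    simp only [← real_inner_smul_left, ← sum_inner, sum_bary_smul_sub]
  simp only [hvertex, mul_sub, Finset.sum_sub_distrib, ← Finset.sum_mul, sum_bary,
    mul_left_comm _ (2 : ℝ), ← Finset.mul_sum, hinner]
  rw [← sub_sub_sub_cancel_right x c O, norm_sub_sq_real, depth]
  ring

lemma depth_eq_sum (x : E) : depth T x = ∑ i, bary T i x * ‖T.points i - x‖ ^ 2 := by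
  have h := norm_sub_sq_eq T x x
  rw [sub_self, norm_zero] at h
  linarith

lemma mem_range_points_of_depth_eq_zero (hx : ∀ i, 0 ≤ bary T i x) (h : depth T x = 0) :
    x ∈ range T.points := by
  rw [depth_eq_sum, Finset.sum_eq_zero_iff_of_nonneg fun i _ =>
    mul_nonneg (hx i) (sq_nonneg _)] at h
  obtain ⟨i, hi⟩ : ∃ i, bary T i x ≠ 0 := by
    by_contra! hzero
    simpa [hzero] using sum_bary T x
  have hnorm := (mul_eq_zero.1 (h i (Finset.mem_univ i))).resolve_left hi
  exact ⟨i, sub_eq_zero.1 (norm_eq_zero.1 (pow_eq_zero_iff two_ne_zero |>.1 hnorm))⟩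

lemma depth_pos [NeZero n] (hx : ∀ i, 0 < bary T i x) : 0 < depth T x := by
  have hnonneg : 0 ≤ depth T x := by
    rw [depth_eq_sum]
    exact Finset.sum_nonneg fun i _ => mul_nonneg (hx i).le (sq_nonneg _)
  refine hnonneg.lt_of_ne fun h => ?_
  obtain ⟨i, rfl⟩ := mem_range_points_of_depth_eq_zero T (fun i => (hx i).le) h.symm
  obtain ⟨j, hj⟩ := exists_ne i
  exact (hx j).ne' (bary_points_of_ne T hj)

end Barycentric

section VertexPowers

/-- The centre of the sphere with respect to which the `i`-th vertex of `T` has power `a i`. -/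
noncomputable def powerCenter (a : Fin (n + 1) → ℝ) : E :=
  T.circumcenter - (1 / 2 : ℝ) • ∑ i, a i • baryGrad T i

/-- The quadratic function of the vertex powers of a sphere that gives the difference of the squared
radii of this sphere and the circumsphere. -/
noncomputable def powerForm (a : Fin (n + 1) → ℝ) : ℝ :=
  ‖∑ i, a i • baryGrad T i‖ ^ 2 / 4 - ∑ i, a i * bary T i T.circumcenter

lemma inner_sum_smul_baryGrad (a : Fin (n + 1) → ℝ) (x y : E) :
    ⟪∑ i, a i • baryGrad T i, y - x⟫ = ∑ i, a i * bary T i y - ∑ i, a i * bary T i x := by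
  simp only [bary_eq_add_inner T _ x y, mul_add, Finset.sum_add_distrib, add_sub_cancel_left,
    sum_inner, real_inner_smul_left]

lemma norm_sub_powerCenter_sq (a : Fin (n + 1) → ℝ) (x : E) :
    ‖x - powerCenter T a‖ ^ 2 =
      T.circumradius ^ 2 + powerForm T a + ∑ i, a i * bary T i x - depth T x := by
  have hinner := inner_sum_smul_baryGrad T a T.circumcenter x
  rw [powerCenter, ← sub_add, add_comm, norm_add_sq_real, real_inner_smul_left, hinner, norm_smul,
    Real.norm_of_nonneg one_half_pos.le, powerForm, depth]
  ring

variable {T} {a : Fin (n + 1) → ℝ} {c : E}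

lemma norm_sub_sq_eq_of_vertexPowers (ha : ∀ i, ‖T.points i - c‖ ^ 2 - ρ ^ 2 = a i) (x : E) :
    ‖x - c‖ ^ 2 = ρ ^ 2 + ∑ i, a i * bary T i x - depth T x := by
  simp only [norm_sub_sq_eq T x c, ← ha, sub_mul, Finset.sum_sub_distrib, ← Finset.mul_sum,
    sum_bary, mul_comm (bary T _ x)]
  ring

lemma eq_powerCenter (ha : ∀ i, ‖T.points i - c‖ ^ 2 - ρ ^ 2 = a i) : c = powerCenter T a := by
  set O := T.circumcenter with hO
  have hgrad : (2 : ℝ) • (O - c) = ∑ i, a i • baryGrad T i := by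
    refine ext_inner_right ℝ fun w => ?_
    have hinner := inner_sum_smul_baryGrad T a O (w + O)
    have hw := norm_sub_sq_eq_of_vertexPowers ha (w + O)
    have h0 := norm_sub_sq_eq_of_vertexPowers ha O
    rw [add_sub_assoc, norm_add_sq_real, depth, ← hO, add_sub_cancel_right] at hw
    rw [depth, ← hO, sub_self, norm_zero] at h0
    rw [add_sub_cancel_right] at hinner
    rw [real_inner_smul_left, hinner, real_inner_comm]
    linarith
  rw [powerCenter, ← hgrad, smul_smul, one_div, inv_mul_cancel₀ two_ne_zero, one_smul,
    sub_sub_cancel]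

lemma powerForm_eq (ha : ∀ i, ‖T.points i - c‖ ^ 2 - ρ ^ 2 = a i) :
    powerForm T a = ρ ^ 2 - T.circumradius ^ 2 := by
  have h1 := norm_sub_powerCenter_sq T a c
  have h2 := norm_sub_sq_eq_of_vertexPowers ha c
  rw [← eq_powerCenter ha] at h1
  linarith

lemma powerForm_single (i : Fin (n + 1)) (k : ℝ) :
    powerForm T (Pi.single i k) =
      ‖baryGrad T i‖ ^ 2 * k ^ 2 / 4 - bary T i T.circumcenter * k := by
  simp only [powerForm, Pi.single_apply, ite_smul, zero_smul, ite_mul, zero_mul,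
    Finset.sum_ite_eq', Finset.mem_univ, if_true, norm_smul, mul_pow, Real.norm_eq_abs, sq_abs]
  ring

variable (T) in
lemma convexOn_powerForm : ConvexOn ℝ univ (powerForm T) := by
  have hlin : ConvexOn ℝ univ fun a : Fin (n + 1) → ℝ => -∑ i, a i * bary T i T.circumcenter :=
    LinearMap.convexOn (-Fintype.linearCombination ℝ fun i => bary T i T.circumcenter) convex_univ
  have hsq : ConvexOn ℝ univ fun a : Fin (n + 1) → ℝ => ‖∑ i, a i • baryGrad T i‖ ^ 2 :=
    (convexOn_univ_norm.comp_linearMap (Fintype.linearCombination ℝ (baryGrad T))).pow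
      (fun _ _ => norm_nonneg _) 2
  refine ((hsq.smul (show (0 : ℝ) ≤ 1 / 4 by norm_num)).add hlin).congr fun a _ => ?_
  simp only [Pi.add_apply, smul_eq_mul, powerForm]
  ring

end VertexPowers

section FacetBalls

/-- The power of the opposite vertex with respect to the sphere of radius `ρ` through the facet
opposite to the `i`-th vertex: the nonnegative root `k` of
`powerForm T (Pi.single i k) = ρ ^ 2 - T.circumradius ^ 2`. -/
noncomputable def facetPower (i : Fin (n + 1)) (ρ : ℝ) : ℝ :=
  2 * (bary T i T.circumcenter +
    √(bary T i T.circumcenter ^ 2 + ‖baryGrad T i‖ ^ 2 * (ρ ^ 2 - T.circumradius ^ 2))) /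
    ‖baryGrad T i‖ ^ 2

lemma continuous_facetPower (i : Fin (n + 1)) : Continuous (facetPower T i) := by
  unfold facetPower
  fun_prop

variable [NeZero n] {i : Fin (n + 1)}

lemma tendsto_facetPower_atTop (i : Fin (n + 1)) :
    Filter.Tendsto (facetPower T i) Filter.atTop Filter.atTop := by
  have hG := pow_pos (norm_baryGrad_pos T i) 2
  exact Filter.Tendsto.atTop_div_const hG (Filter.Tendsto.const_mul_atTop two_pos
    (Filter.tendsto_atTop_add_const_left _ _ (Real.tendsto_sqrt_atTop.comp
      (Filter.tendsto_atTop_add_const_left _ _ (Filter.Tendsto.const_mul_atTop hG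
        (Filter.tendsto_atTop_add_const_right _ _ (Filter.tendsto_pow_atTop two_ne_zero)))))))

variable {T}

lemma powerForm_single_facetPower (hρ : T.circumradius < ρ) (i : Fin (n + 1)) :
    powerForm T (Pi.single i (facetPower T i ρ)) = ρ ^ 2 - T.circumradius ^ 2 := by
  have hG := pow_pos (norm_baryGrad_pos T i) 2
  have hd := sq_sub_sq_circumradius_pos hρ
  have hsqrt := Real.sq_sqrt (add_nonneg (sq_nonneg (bary T i T.circumcenter))
    (mul_pos hG hd).le)
  rw [powerForm_single, facetPower]
  set s := √(bary T i T.circumcenter ^ 2 + ‖baryGrad T i‖ ^ 2 * (ρ ^ 2 - T.circumradius ^ 2))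
  set g := ‖baryGrad T i‖ ^ 2
  have hg := hG.ne'
  field_simp
  linear_combination 4 * hsqrt

lemma facetPower_pos (hρ : T.circumradius < ρ) (i : Fin (n + 1)) : 0 < facetPower T i ρ := by
  have hG := pow_pos (norm_baryGrad_pos T i) 2
  have hlt : |bary T i T.circumcenter| < √(bary T i T.circumcenter ^ 2 +
      ‖baryGrad T i‖ ^ 2 * (ρ ^ 2 - T.circumradius ^ 2)) :=
    Real.lt_sqrt_of_sq_lt (by
      rw [sq_abs]
      exact lt_add_of_pos_right _ (mul_pos hG (sq_sub_sq_circumradius_pos hρ)))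
  exact div_pos (mul_pos two_pos (by linarith [neg_abs_le (bary T i T.circumcenter)])) hG

lemma facetPower_lt_facetPower (hρ : T.circumradius < ρ) (h : ρ < ρ') (i : Fin (n + 1)) :
    facetPower T i ρ < facetPower T i ρ' := by
  have hG := norm_baryGrad_pos T i
  have hd := sq_sub_sq_circumradius_pos hρ
  have hsq : ρ ^ 2 < ρ' ^ 2 := pow_lt_pow_left₀ h (T.circumradius_nonneg.trans hρ.le) two_ne_zero
  unfold facetPower
  gcongr

/-- The two roots of the quadratic equation have a negative product. -/
lemma eq_facetPower (hρ : T.circumradius < ρ) {k : ℝ} (hk : 0 ≤ k)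
    (h : powerForm T (Pi.single i k) = ρ ^ 2 - T.circumradius ^ 2) : k = facetPower T i ρ := by
  have hroot := powerForm_single_facetPower hρ i
  have hpos := facetPower_pos hρ i
  have hd := sq_sub_sq_circumradius_pos hρ
  rw [powerForm_single] at h hroot
  set k' := facetPower T i ρ
  have hprod : (k - k') * (‖baryGrad T i‖ ^ 2 * k * k' / 4 + (ρ ^ 2 - T.circumradius ^ 2)) = 0 := by
    linear_combination k' * h - k * hroot
  exact sub_eq_zero.1 ((mul_eq_zero.1 hprod).resolve_right (by positivity))

variable (T) in
/-- The centre of the sphere of radius `ρ` through the facet opposite to the `i`-th vertex, whose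
ball does not contain this vertex. -/
noncomputable def facetCenter (ρ : ℝ) (i : Fin (n + 1)) : E :=
  powerCenter T (Pi.single i (facetPower T i ρ))

lemma norm_sub_facetCenter_sq (hρ : T.circumradius < ρ) (i : Fin (n + 1)) (x : E) :
    ‖x - facetCenter T ρ i‖ ^ 2 = ρ ^ 2 + facetPower T i ρ * bary T i x - depth T x := by
  rw [facetCenter, norm_sub_powerCenter_sq, powerForm_single_facetPower hρ]
  simp only [Pi.single_apply, ite_mul, zero_mul, Finset.sum_ite_eq', Finset.mem_univ, if_true]
  ring

lemma mem_ball_facetCenter (hρ : T.circumradius < ρ) :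
    x ∈ ball (facetCenter T ρ i) ρ ↔ facetPower T i ρ * bary T i x < depth T x := by
  rw [mem_ball_iff_norm, ← sq_lt_sq₀ (norm_nonneg _) (T.circumradius_nonneg.trans hρ.le),
    norm_sub_facetCenter_sq hρ, add_sub_assoc, add_lt_iff_neg_left, sub_neg]

lemma mem_sphere_facetCenter (hρ : T.circumradius < ρ) :
    x ∈ sphere (facetCenter T ρ i) ρ ↔ depth T x = facetPower T i ρ * bary T i x := by
  rw [mem_sphere_iff_norm, ← sq_eq_sq₀ (norm_nonneg _) (T.circumradius_nonneg.trans hρ.le),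
    norm_sub_facetCenter_sq hρ, add_sub_assoc, add_eq_left, sub_eq_zero, eq_comm]

lemma isFacetCenter_iff (hρ : T.circumradius < ρ) {p : E} :
    IsFacetCenter T i ρ p ↔ p = facetCenter T ρ i := by
  refine ⟨fun ⟨hj, hi⟩ => ?_, ?_⟩
  · set k := ‖T.points i - p‖ ^ 2 - ρ ^ 2 with hk
    have hk0 : 0 ≤ k := by
      rw [mem_ball_iff_norm, not_lt] at hi
      exact sub_nonneg.2 (pow_le_pow_left₀ (T.circumradius_nonneg.trans hρ.le) hi 2)
    have ha (j : Fin (n + 1)) :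
        ‖T.points j - p‖ ^ 2 - ρ ^ 2 = (Pi.single i k : Fin (n + 1) → ℝ) j := by
      by_cases h : j = i
      · rw [h, Pi.single_eq_same]
      · rw [Pi.single_eq_of_ne h, mem_sphere_iff_norm.1 (hj j h), sub_self]
    rw [eq_powerCenter ha, facetCenter, eq_facetPower hρ hk0 (powerForm_eq ha)]
  · rintro rfl
    refine ⟨fun j hj => ?_, ?_⟩
    · rw [mem_sphere_facetCenter hρ, depth_points, bary_points_of_ne T hj.symm, mul_zero]
    · rw [mem_ball_facetCenter hρ, depth_points, bary_points_self, mul_one, not_lt]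
      exact (facetPower_pos hρ i).le

lemma disjoint_ball_facetCenter (hρ : T.circumradius < ρ) (i : Fin (n + 1)) :
    Disjoint (ball (facetCenter T ρ i) ρ) (range T.points) := by
  rw [disjoint_right]
  rintro _ ⟨j, rfl⟩
  by_cases h : j = i
  · exact h ▸ ((isFacetCenter_iff hρ).2 rfl).2
  · exact fun hj => (((isFacetCenter_iff hρ).2 rfl).1 j h).not_lt hj

end FacetBalls

section Core

/-- The part of the open circumball outside the facet balls of radius `ρ`. -/
def core (ρ : ℝ) : Set E :=
  {x | 0 < depth T x ∧ ∀ i, depth T x ≤ facetPower T i ρ * bary T i x}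

variable {T} [NeZero n]

lemma bary_pos_of_mem_core (hρ : T.circumradius < ρ) (hx : x ∈ core T ρ) (i : Fin (n + 1)) :
    0 < bary T i x :=
  pos_of_mul_pos_right (hx.1.trans_le (hx.2 i)) (facetPower_pos hρ i).le

lemma interior_convexHull_sdiff_iUnion_ball (hρ : T.circumradius < ρ) :
    interior (convexHull ℝ (range T.points)) \ ⋃ i, ball (facetCenter T ρ i) ρ = core T ρ := by
  ext x
  simp only [mem_sdiff, mem_interior_convexHull_iff, mem_iUnion, mem_ball_facetCenter hρ,
    not_exists, not_lt]
  exact ⟨fun h => ⟨depth_pos T h.1, h.2⟩, fun h => ⟨bary_pos_of_mem_core hρ h, h.2⟩⟩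

lemma ballHull_subset_union_core (hρ : T.circumradius < ρ) :
    ballHull ρ (range T.points) ⊆ range T.points ∪ core T ρ := by
  refine fun x hx => or_iff_not_imp_left.2 fun hxV => ⟨?_, fun i => ?_⟩
  · have hxO := mem_ball_of_mem_ballHull (finite_range T.points).isClosed
      (range_subset_iff.2 fun i => (T.dist_circumcenter_eq_circumradius i).le)
      (circumradius_pos T) ((circumradius_pos T).trans hρ) hx hxV
    exact sub_pos.2 (pow_lt_pow_left₀ (mem_ball_iff_norm.1 hxO) (norm_nonneg _) two_ne_zero)
  · have hxi := mem_ballHull.1 hx _ (disjoint_ball_facetCenter hρ i)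
    rwa [mem_ball_facetCenter hρ, not_lt] at hxi

/-- By convexity of `powerForm`, whose values at `0` and at the points `Pi.single i k` for the
facet powers `k` are `0` and `ρ ^ 2 - T.circumradius ^ 2`. -/
lemma one_le_sum_div_facetPower (hρ : T.circumradius < ρ) {a : Fin (n + 1) → ℝ}
    (ha : ∀ i, 0 ≤ a i) (h : powerForm T a = ρ ^ 2 - T.circumradius ^ 2) :
    1 ≤ ∑ i, a i / facetPower T i ρ := by
  by_contra! hlt
  have hd := sq_sub_sq_circumradius_pos hρ
  set w := fun i => a i / facetPower T i ρ with hw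
  have hsum : a = (1 - ∑ i, w i) • 0 + ∑ i, w i • Pi.single i (facetPower T i ρ) := by
    ext i
    simp [hw, Finset.sum_apply, Pi.single_apply, (facetPower_pos hρ i).ne']
  have hzero : powerForm T (0 : Fin (n + 1) → ℝ) = 0 := by simp [powerForm]
  have hconv := (convexOn_powerForm T).map_add_sum_le (t := Finset.univ) (w := w)
    (p := fun i => Pi.single i (facetPower T i ρ)) (q := 0) (v := 1 - ∑ i, w i)
    (fun i _ => div_nonneg (ha i) (facetPower_pos hρ i).le) (sub_add_cancel _ _)
    (fun _ _ => mem_univ _) (sub_nonneg.2 hlt.le) (mem_univ _)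
  rw [← hsum, h, hzero, smul_zero, zero_add] at hconv
  simp only [powerForm_single_facetPower hρ, smul_eq_mul, ← Finset.sum_mul] at hconv
  exact (mul_lt_of_lt_one_left hd hlt).not_ge hconv

lemma core_subset_ballHull (hρ : T.circumradius < ρ) :
    core T ρ ⊆ ballHull ρ (range T.points) := by
  refine fun x hx => mem_ballHull.2 fun c hc hxc => ?_
  set a := fun i => ‖T.points i - c‖ ^ 2 - ρ ^ 2
  have ha (i : Fin (n + 1)) : 0 ≤ a i :=
    sub_nonneg.2 (pow_le_pow_left₀ (T.circumradius_nonneg.trans hρ.le)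
      ((disjoint_ball_iff.1 hc _ (mem_range_self i)).trans_eq (dist_eq_norm _ _)) 2)
  have hsum : depth T x ≤ ∑ i, a i * bary T i x :=
    calc depth T x ≤ (∑ i, a i / facetPower T i ρ) * depth T x :=
          le_mul_of_one_le_left hx.1.le
            (one_le_sum_div_facetPower hρ ha (powerForm_eq (c := c) fun _ => rfl))
      _ = ∑ i, a i * (depth T x / facetPower T i ρ) := by
          rw [Finset.sum_mul]
          exact Finset.sum_congr rfl fun i _ => div_mul_comm _ _ _ |>.trans (mul_comm _ _)
      _ ≤ ∑ i, a i * bary T i x := Finset.sum_le_sum fun i _ =>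
          mul_le_mul_of_nonneg_left ((div_le_iff₀' (facetPower_pos hρ i)).2 (hx.2 i)) (ha i)
  have hlt := pow_lt_pow_left₀ (mem_ball_iff_norm.1 hxc) (norm_nonneg _) two_ne_zero
  rw [norm_sub_sq_eq_of_vertexPowers (a := a) fun _ => rfl] at hlt
  linarith

theorem ballHull_eq_union_core (hρ : T.circumradius < ρ) :
    ballHull ρ (range T.points) = range T.points ∪ core T ρ :=
  (ballHull_subset_union_core hρ).antisymm
    (union_subset (subset_ballHull _ _) (core_subset_ballHull hρ))

end Core

section RadicalCenter

/-- The radical centre of the spheres of radius `ρ` through the facets: the powers of a point with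
respect to these spheres agree when its barycentric coordinates are inversely proportional to the
facet powers. -/
noncomputable def radicalCenter (ρ : ℝ) : E :=
  Finset.univ.centerMass (fun i => (facetPower T i ρ)⁻¹) T.points

/-- The common power of the radical centre with respect to the spheres of radius `ρ` through the
facets. -/
noncomputable def radicalPower (ρ : ℝ) : ℝ :=
  (∑ i, (facetPower T i ρ)⁻¹)⁻¹ - depth T (radicalCenter T ρ)

variable {T} [NeZero n]

lemma sum_inv_facetPower_pos (hρ : T.circumradius < ρ) : 0 < ∑ i, (facetPower T i ρ)⁻¹ :=
  Finset.sum_pos (fun i _ => inv_pos.2 (facetPower_pos hρ i)) Finset.univ_nonempty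

lemma continuousOn_radicalPower : ContinuousOn (radicalPower T) (Ioi T.circumradius) := by
  have hinv (i : Fin (n + 1)) :
      ContinuousOn (fun ρ => (facetPower T i ρ)⁻¹) (Ioi T.circumradius) :=
    (continuous_facetPower T i).continuousOn.inv₀ fun ρ hρ => (facetPower_pos hρ i).ne'
  have hsum : ContinuousOn (fun ρ => (∑ i, (facetPower T i ρ)⁻¹)⁻¹) (Ioi T.circumradius) :=
    (continuousOn_finsetSum _ fun i _ => hinv i).inv₀ fun ρ hρ => (sum_inv_facetPower_pos hρ).ne'
  exact hsum.sub ((continuous_depth T).comp_continuousOn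
    (hsum.smul (continuousOn_finsetSum _ fun i _ => (hinv i).smul continuousOn_const)))

lemma bary_radicalCenter (hρ : T.circumradius < ρ) (i : Fin (n + 1)) :
    bary T i (radicalCenter T ρ) = (facetPower T i ρ)⁻¹ / ∑ j, (facetPower T j ρ)⁻¹ :=
  bary_centerMass T (sum_inv_facetPower_pos hρ).ne' i

lemma bary_radicalCenter_pos (hρ : T.circumradius < ρ) (i : Fin (n + 1)) :
    0 < bary T i (radicalCenter T ρ) := by
  rw [bary_radicalCenter hρ]
  exact div_pos (inv_pos.2 (facetPower_pos hρ i)) (sum_inv_facetPower_pos hρ)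

lemma facetPower_mul_bary_radicalCenter (hρ : T.circumradius < ρ) (i : Fin (n + 1)) :
    facetPower T i ρ * bary T i (radicalCenter T ρ) =
      depth T (radicalCenter T ρ) + radicalPower T ρ := by
  rw [bary_radicalCenter hρ, ← mul_div_assoc, mul_inv_cancel₀ (facetPower_pos hρ i).ne', one_div,
    radicalPower, add_sub_cancel]

lemma radicalCenter_mem_core (hρ : T.circumradius < ρ) (h : 0 ≤ radicalPower T ρ) :
    radicalCenter T ρ ∈ core T ρ :=
  ⟨depth_pos T (bary_radicalCenter_pos hρ), fun i => by
    rw [facetPower_mul_bary_radicalCenter hρ]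
    exact le_add_of_nonneg_right h⟩

/-- Compare `depth T x = ∑ i, bary T i x * ‖T.points i - x‖ ^ 2` with the analogous sum for the
coordinates of the radical centre: a point of the core satisfies
`depth T x / facetPower T i ρ ≤ bary T i x`. -/
lemma norm_radicalCenter_sub_sq_le (hρ : T.circumradius < ρ) (hx : x ∈ core T ρ) :
    ‖radicalCenter T ρ - x‖ ^ 2 ≤ radicalPower T ρ := by
  set z := radicalCenter T ρ with hz
  set S := ∑ i, (facetPower T i ρ)⁻¹ with hS
  have hS0 : 0 < S := sum_inv_facetPower_pos hρ
  have hbary (i : Fin (n + 1)) : depth T x * S * bary T i z ≤ bary T i x := by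
    rw [hz, bary_radicalCenter hρ, ← hS, mul_assoc, mul_div_cancel₀ _ hS0.ne',
      ← div_eq_mul_inv, div_le_iff₀' (facetPower_pos hρ i)]
    exact hx.2 i
  have hle : depth T x * S * (‖z - x‖ ^ 2 + depth T z) ≤ depth T x * 1 :=
    calc depth T x * S * (‖z - x‖ ^ 2 + depth T z)
        = ∑ i, depth T x * S * bary T i z * ‖T.points i - x‖ ^ 2 := by
          rw [norm_sub_sq_eq T z x, sub_add_cancel, Finset.mul_sum]
          simp only [mul_assoc]
      _ ≤ ∑ i, bary T i x * ‖T.points i - x‖ ^ 2 :=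
          Finset.sum_le_sum fun i _ => mul_le_mul_of_nonneg_right (hbary i) (sq_nonneg _)
      _ = depth T x * 1 := by rw [mul_one, ← depth_eq_sum]
  rw [mul_assoc, mul_le_mul_iff_right₀ hx.1, ← le_div_iff₀' hS0, one_div] at hle
  exact le_sub_iff_add_le.2 hle

lemma core_nonempty_iff (hρ : T.circumradius < ρ) :
    (core T ρ).Nonempty ↔ 0 ≤ radicalPower T ρ :=
  ⟨fun ⟨_, hx⟩ => (sq_nonneg _).trans (norm_radicalCenter_sub_sq_le hρ hx),
    fun h => ⟨_, radicalCenter_mem_core hρ h⟩⟩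

lemma core_eq_singleton (hρ : T.circumradius < ρ) (h : radicalPower T ρ = 0) :
    core T ρ = {radicalCenter T ρ} := by
  refine Subset.antisymm (fun x hx => ?_) (singleton_subset_iff.2 (radicalCenter_mem_core hρ h.ge))
  have hle := (norm_radicalCenter_sub_sq_le hρ hx).trans_eq h
  rw [sq_nonpos_iff, norm_eq_zero, sub_eq_zero] at hle
  exact hle.symm

lemma iInter_sphere_facetCenter (hρ : T.circumradius < ρ) (h : radicalPower T ρ = 0) :
    ⋂ i, sphere (facetCenter T ρ i) ρ = {radicalCenter T ρ} := by
  ext x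
  simp only [mem_iInter, mem_sphere_facetCenter hρ, mem_singleton_iff]
  refine ⟨fun hx => bary_ext T fun i => ?_, ?_⟩
  · have hbary (j : Fin (n + 1)) : bary T j x = depth T x * (facetPower T j ρ)⁻¹ := by
      rw [hx j, mul_comm, inv_mul_cancel_left₀ (facetPower_pos hρ j).ne']
    have hsum := sum_bary T x
    simp only [hbary, ← Finset.mul_sum] at hsum
    rw [hbary, bary_radicalCenter hρ, eq_div_iff (sum_inv_facetPower_pos hρ).ne', mul_right_comm,
      hsum, one_mul]
  · rintro rfl i
    rw [facetPower_mul_bary_radicalCenter hρ, h, add_zero]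

lemma radicalPower_pos_of_core_nonempty (hρ : T.circumradius < ρ) (h : ρ < ρ')
    (hne : (core T ρ).Nonempty) : 0 < radicalPower T ρ' := by
  have hρ' := hρ.trans h
  obtain ⟨x, hx⟩ := hne
  have hlt (i : Fin (n + 1)) : depth T x < facetPower T i ρ' * bary T i x :=
    (hx.2 i).trans_lt (mul_lt_mul_of_pos_right (facetPower_lt_facetPower hρ h i)
      (bary_pos_of_mem_core hρ hx i))
  have hx' : x ∈ core T ρ' := ⟨hx.1, fun i => (hlt i).le⟩
  refine ((core_nonempty_iff hρ').1 ⟨x, hx'⟩).lt_of_ne' fun hzero => ?_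
  rw [core_eq_singleton hρ' hzero, mem_singleton_iff] at hx'
  have := hlt 0
  rw [hx', facetPower_mul_bary_radicalCenter hρ', hzero, add_zero] at this
  exact this.false

end RadicalCenter

section FullnessRadius

variable {T}

lemma mem_interior_core (h0 : 0 < depth T x)
    (h : ∀ i, depth T x < facetPower T i ρ * bary T i x) : x ∈ interior (core T ρ) := by
  have hopen : IsOpen ({y | 0 < depth T y} ∩
      ⋂ i, {y | depth T y < facetPower T i ρ * bary T i y}) :=
    (isOpen_lt continuous_const (continuous_depth T)).inter (isOpen_iInter_of_finite fun i =>
      isOpen_lt (continuous_depth T) (continuous_const.mul (continuous_bary T i)))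
  exact mem_interior.2 ⟨_, fun y hy => ⟨hy.1, fun i => (mem_iInter.1 hy.2 i).le⟩, hopen, h0,
    mem_iInter.2 h⟩

variable [NeZero n]

lemma interior_core_nonempty (hρ : T.circumradius < ρ) (h : 0 < radicalPower T ρ) :
    (interior (core T ρ)).Nonempty :=
  ⟨radicalCenter T ρ, mem_interior_core (depth_pos T (bary_radicalCenter_pos hρ)) fun i => by
    rw [facetPower_mul_bary_radicalCenter hρ]
    exact lt_add_of_pos_right _ h⟩

lemma core_nonempty_of_interior_ballHull_nonempty (hρ : T.circumradius < ρ)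
    (h : (interior (ballHull ρ (range T.points))).Nonempty) : (core T ρ).Nonempty := by
  have : Nontrivial E := ⟨T.points 0, T.points (Fin.last n), fun h =>
    Fin.last_pos'.ne (T.independent.injective h)⟩
  obtain ⟨x, hx, hxV⟩ :=
    ((finite_range T.points).countable.dense_compl ℝ).inter_open_nonempty _ isOpen_interior h
  exact ⟨x, (ballHull_subset_union_core hρ (interior_subset hx)).resolve_left hxV⟩

variable (T) in
lemma exists_interior_ballHull_nonempty :
    ∃ ρ, T.circumradius < ρ ∧ (interior (ballHull ρ (range T.points))).Nonempty := by
  obtain ⟨c, hc⟩ : (interior (convexHull ℝ (range T.points))).Nonempty :=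
    ⟨_, (vertexBasis T).centroid_mem_interior_convexHull⟩
  rw [mem_interior_convexHull_iff] at hc
  have hlarge : ∀ᶠ ρ in Filter.atTop, ∀ i, depth T c < facetPower T i ρ * bary T i c :=
    Filter.eventually_all.2 fun i =>
      ((tendsto_facetPower_atTop T i).atTop_mul_const (hc i)).eventually_gt_atTop _
  obtain ⟨ρ, hcore, hρ⟩ := (hlarge.and (Filter.eventually_gt_atTop T.circumradius)).exists
  exact ⟨ρ, hρ, c,
    interior_mono (core_subset_ballHull hρ) (mem_interior_core (depth_pos T hc) hcore)⟩

variable (T) in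
lemma circumradius_le_fullnessRadius : T.circumradius ≤ fullnessRadius T :=
  le_csInf (exists_interior_ballHull_nonempty T) fun _ h => h.1.le

lemma radicalPower_pos_of_fullnessRadius_lt (h : fullnessRadius T < ρ) : 0 < radicalPower T ρ := by
  obtain ⟨ρ₀, ⟨hρ₀, hfull⟩, hlt⟩ := exists_lt_of_csInf_lt (exists_interior_ballHull_nonempty T) h
  exact radicalPower_pos_of_core_nonempty hρ₀ hlt
    (core_nonempty_of_interior_ballHull_nonempty hρ₀ hfull)

lemma radicalPower_neg_of_lt_fullnessRadius (hρ : T.circumradius < ρ) (h : ρ < fullnessRadius T) :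
    radicalPower T ρ < 0 := by
  by_contra! hnonneg
  obtain ⟨ρ', hρρ', hρ'⟩ := exists_between h
  have hpos := radicalPower_pos_of_core_nonempty hρ hρρ' ((core_nonempty_iff hρ).2 hnonneg)
  have hfull := (interior_core_nonempty (hρ.trans hρρ') hpos).mono
    (interior_mono (core_subset_ballHull (hρ.trans hρρ')))
  exact hρ'.not_ge (csInf_le ⟨T.circumradius, fun _ h => h.1.le⟩ ⟨hρ.trans hρρ', hfull⟩)

lemma radicalPower_fullnessRadius (h : T.circumradius < fullnessRadius T) :
    radicalPower T (fullnessRadius T) = 0 := by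
  have hcont : ContinuousAt (radicalPower T) (fullnessRadius T) :=
    continuousOn_radicalPower.continuousAt (Ioi_mem_nhds h)
  refine le_antisymm ?_ ?_
  · refine le_of_tendsto
      (hcont.tendsto.mono_left (nhdsWithin_le_nhds (s := Iio (fullnessRadius T)))) ?_
    filter_upwards [Ioo_mem_nhdsLT h] with ρ hρ
    exact (radicalPower_neg_of_lt_fullnessRadius hρ.1 hρ.2).le
  · refine ge_of_tendsto
      (hcont.tendsto.mono_left (nhdsWithin_le_nhds (s := Ioi (fullnessRadius T)))) ?_
    filter_upwards [self_mem_nhdsWithin] with ρ hρ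
    exact (radicalPower_pos_of_fullnessRadius_lt hρ).le

theorem ballHull_eq_range_points_of_lt_fullnessRadius (h0 : 0 < ρ) (h : ρ < fullnessRadius T) :
    ballHull ρ (range T.points) = range T.points := by
  rcases le_or_gt ρ T.circumradius with hρ | hρ
  · exact ballHull_eq_range_points T h0 hρ
  · have hempty : core T ρ = ∅ := not_nonempty_iff_eq_empty.1 fun hne =>
      (radicalPower_neg_of_lt_fullnessRadius hρ h).not_ge ((core_nonempty_iff hρ).1 hne)
    rw [ballHull_eq_union_core hρ, hempty, union_empty]

end FullnessRadius

section Connected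

lemma depth_eq_distForm (x : E) :
    depth T x = distForm T (fun i => bary T i x) (fun i => bary T i x) := by
  have hvertex (i : Fin (n + 1)) : ∑ j, ‖T.points i - T.points j‖ ^ 2 / 2 * bary T j x =
      (‖T.points i - x‖ ^ 2 + depth T x) / 2 := by
    rw [norm_sub_rev, norm_sub_sq_eq T x, sub_add_cancel, Finset.sum_div]
    refine Finset.sum_congr rfl fun j _ => ?_
    rw [norm_sub_rev]
    ring
  simp only [distForm_apply, mul_assoc, ← Finset.mul_sum, hvertex]
  simp only [← mul_div_assoc, mul_add, ← Finset.sum_div, Finset.sum_add_distrib, ← Finset.sum_mul,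
    ← depth_eq_sum, sum_bary]
  ring

lemma depth_centerMass {μ : Fin (n + 1) → ℝ} (hμ : ∑ i, μ i ≠ 0) :
    depth T (Finset.univ.centerMass μ T.points) = distForm T μ μ / (∑ i, μ i) ^ 2 := by
  have hbary : (fun i => bary T i (Finset.univ.centerMass μ T.points)) = (∑ i, μ i)⁻¹ • μ := by
    ext i
    rw [bary_centerMass T hμ, Pi.smul_apply, smul_eq_mul, inv_mul_eq_div]
  rw [depth_eq_distForm, hbary, distForm_smul_self, inv_pow, inv_mul_eq_div]

/-- The face of the nonnegative orthant on which the coordinates in `J` vanish. -/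
def orthantFace {ι : Type*} (J : Set ι) : ConvexCone ℝ (ι → ℝ) where
  carrier := {ν | 0 ≤ ν ∧ ∀ j ∈ J, ν j = 0}
  smul_mem' _ ht _ hν := ⟨smul_nonneg ht.le hν.1, fun j hj => by simp [hν.2 j hj]⟩
  add_mem' _ hν _ hν' := ⟨add_nonneg hν.1 hν'.1, fun j hj => by simp [hν.2 j hj, hν'.2 j hj]⟩

lemma single_add_single_mem_orthantFace {ι : Type*} [DecidableEq ι] {J : Set ι} {j k : ι}
    (hj : j ∉ J) (hk : k ∉ J) : Pi.single j 1 + Pi.single k 1 ∈ orthantFace J := by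
  refine ⟨add_nonneg (Pi.single_nonneg.2 zero_le_one) (Pi.single_nonneg.2 zero_le_one),
    fun i hi => ?_⟩
  rw [Pi.add_apply, Pi.single_eq_of_ne (ne_of_mem_of_not_mem hi hj),
    Pi.single_eq_of_ne (ne_of_mem_of_not_mem hi hk), add_zero]

/-- The part of the core that lies on the facet spheres with index in `J`. -/
def coreStratum (ρ : ℝ) (J : Set (Fin (n + 1))) : Set E :=
  {x ∈ core T ρ | ∀ i ∈ J, depth T x = facetPower T i ρ * bary T i x}

/-- The barycentric weights of the core, normalised so that their sum is the inverse of the depth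
and taken relative to those of the radical centre. -/
def stratumWeights (ρ : ℝ) (J : Set (Fin (n + 1))) : Set (Fin (n + 1) → ℝ) :=
  {ν | ν ∈ orthantFace J ∧ distForm T ((facetPower T · ρ)⁻¹ + ν) ((facetPower T · ρ)⁻¹ + ν) =
    ∑ i, ((facetPower T i ρ)⁻¹ + ν i)}

variable {T} {J : Set (Fin (n + 1))} [NeZero n]

lemma sum_inv_facetPower_add_pos (hρ : T.circumradius < ρ) {ν : Fin (n + 1) → ℝ} (hν : 0 ≤ ν) :
    0 < ∑ i, ((facetPower T i ρ)⁻¹ + ν i) :=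
  Finset.sum_pos (fun i _ => add_pos_of_pos_of_nonneg (inv_pos.2 (facetPower_pos hρ i)) (hν i))
    Finset.univ_nonempty

lemma centerMass_mem_coreStratum (hρ : T.circumradius < ρ) {ν : Fin (n + 1) → ℝ}
    (hν : ν ∈ stratumWeights T ρ J) :
    Finset.univ.centerMass ((facetPower T · ρ)⁻¹ + ν) T.points ∈ coreStratum T ρ J := by
  obtain ⟨⟨hν0, hνJ⟩, hsum⟩ := hν
  set μ := (facetPower T · ρ)⁻¹ + ν
  change distForm T μ μ = ∑ i, μ i at hsum
  have hμ : 0 < ∑ i, μ i := sum_inv_facetPower_add_pos hρ hν0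
  have hdepth : depth T (Finset.univ.centerMass μ T.points) = 1 / ∑ i, μ i := by
    rw [depth_centerMass T hμ.ne', hsum, sq, div_self_mul_self', one_div]
  have hbary (i : Fin (n + 1)) : facetPower T i ρ * bary T i (Finset.univ.centerMass μ T.points) =
      (1 + facetPower T i ρ * ν i) / ∑ i, μ i := by
    rw [bary_centerMass T hμ.ne', ← mul_div_assoc, show μ i = (facetPower T i ρ)⁻¹ + ν i from rfl,
      mul_add, mul_inv_cancel₀ (facetPower_pos hρ i).ne']
  simp only [coreStratum, core, mem_ofPred_eq, hdepth, hbary]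
  refine ⟨⟨one_div_pos.2 hμ, fun i => ?_⟩, fun i hi => by rw [hνJ i hi, mul_zero, add_zero]⟩
  have := mul_nonneg (facetPower_pos hρ i).le (hν0 i)
  gcongr
  linarith

lemma exists_centerMass_eq_of_mem_coreStratum (hρ : T.circumradius < ρ)
    (hx : x ∈ coreStratum T ρ J) :
    ∃ ν ∈ stratumWeights T ρ J,
      Finset.univ.centerMass ((facetPower T · ρ)⁻¹ + ν) T.points = x := by
  obtain ⟨⟨hdepth, hle⟩, heq⟩ := hx
  set μ : Fin (n + 1) → ℝ := (depth T x)⁻¹ • fun i => bary T i x with hμ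
  have hsum : ∑ i, μ i = (depth T x)⁻¹ := by
    simp only [hμ, Pi.smul_apply, smul_eq_mul, ← Finset.mul_sum, sum_bary, mul_one]
  have hform : distForm T μ μ = ∑ i, μ i := by
    rw [hμ, distForm_smul_self, ← depth_eq_distForm, ← hμ, hsum]
    field_simp
  have hcoord (i : Fin (n + 1)) : μ i - (facetPower T i ρ)⁻¹ =
      (facetPower T i ρ * bary T i x - depth T x) / (facetPower T i ρ * depth T x) := by
    have hk := facetPower_pos hρ i
    rw [hμ, Pi.smul_apply, smul_eq_mul]
    field_simp
  refine ⟨μ - (facetPower T · ρ)⁻¹, ⟨⟨fun i => ?_, fun i hi => ?_⟩, ?_⟩, ?_⟩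
  · exact (div_nonneg (sub_nonneg.2 (hle i))
      (mul_pos (facetPower_pos hρ i) hdepth).le).trans_eq (hcoord i).symm
  · exact (hcoord i).trans (by rw [heq i hi, sub_self, zero_div])
  · simp only [add_sub_cancel, hform, Pi.sub_apply, Pi.inv_apply]
  · rw [add_sub_cancel]
    refine bary_ext T fun i => ?_
    rw [bary_centerMass T (hsum ▸ inv_ne_zero hdepth.ne'), hsum, hμ, Pi.smul_apply, smul_eq_mul,
      mul_div_cancel_left₀ _ (inv_ne_zero hdepth.ne')]

lemma coreStratum_eq_image (hρ : T.circumradius < ρ) : coreStratum T ρ J =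
    (fun ν => Finset.univ.centerMass ((facetPower T · ρ)⁻¹ + ν) T.points) ''
      stratumWeights T ρ J :=
  Subset.antisymm (fun _ hx => exists_centerMass_eq_of_mem_coreStratum hρ hx)
    (image_subset_iff.2 fun _ hν => centerMass_mem_coreStratum hρ hν)

lemma distForm_inv_facetPower_lt (hρ : T.circumradius < ρ) (h : 0 < radicalPower T ρ) :
    distForm T (facetPower T · ρ)⁻¹ (facetPower T · ρ)⁻¹ < ∑ i, (facetPower T i ρ)⁻¹ := by
  have hS := sum_inv_facetPower_pos hρ
  have hdepth : depth T (radicalCenter T ρ) =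
      distForm T (facetPower T · ρ)⁻¹ (facetPower T · ρ)⁻¹ / (∑ i, (facetPower T i ρ)⁻¹) ^ 2 :=
    depth_centerMass T hS.ne'
  rw [radicalPower, hdepth, sub_pos, div_lt_iff₀ (pow_pos hS 2), sq,
    inv_mul_cancel_left₀ hS.ne'] at h
  exact h

lemma isConnected_stratumWeights (hρ : T.circumradius < ρ) (h : 0 < radicalPower T ρ)
    (hJ : ∃ j ∉ J, ∃ k ∉ J, j ≠ k) : IsConnected (stratumWeights T ρ J) := by
  set κ : Fin (n + 1) → ℝ := (facetPower T · ρ)⁻¹ with hκ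
  have hC : 0 < ∑ i, κ i - distForm T κ κ := sub_pos.2 (distForm_inv_facetPower_lt hρ h)
  have hlevel : stratumWeights T ρ J = {ν | ν ∈ orthantFace J ∧
      distForm T ν ν + (2 * distForm T κ ν - ∑ i, ν i) = ∑ i, κ i - distForm T κ κ} := by
    ext ν
    refine and_congr_right fun _ => ?_
    have hsum : ∑ i, ((facetPower T i ρ)⁻¹ + ν i) = ∑ i, κ i + ∑ i, ν i := Finset.sum_add_distrib
    rw [hsum, ← hκ, distForm_add_self]
    exact ⟨fun h => by linarith, fun h => by linarith⟩
  obtain ⟨j, hj, k, hk, hjk⟩ := hJ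
  rw [hlevel]
  refine isConnected_levelSet_of_superadditive (K := orthantFace J)
    (b := fun ν => 2 * distForm T κ ν - ∑ i, ν i) (continuous_distForm_self T)
    ((continuous_const.mul (distForm T κ).continuous_of_finiteDimensional).sub (by fun_prop))
    (fun t _ ν => distForm_smul_self T t ν) (fun t _ ν => ?_) (fun ν hν ν' hν' => ?_)
    (fun ν _ ν' _ => ?_) (fun ν hν => distForm_nonneg T hν.1 hν.1)
    ⟨_, single_add_single_mem_orthantFace hj hk, distForm_single_add_single_pos T hjk⟩ hC
  · simp only [map_smul, smul_eq_mul, Pi.smul_apply, ← Finset.mul_sum]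
    ring
  · rw [distForm_add_self]
    linarith [distForm_nonneg T hν.1 hν'.1]
  · simp only [map_add, Pi.add_apply, Finset.sum_add_distrib]
    linarith

lemma isConnected_coreStratum (hρ : T.circumradius < ρ) (h : 0 < radicalPower T ρ)
    (hJ : ∃ j ∉ J, ∃ k ∉ J, j ≠ k) : IsConnected (coreStratum T ρ J) := by
  rw [coreStratum_eq_image hρ]
  refine (isConnected_stratumWeights hρ h hJ).image _ ?_
  have hsum : ContinuousOn (fun ν : Fin (n + 1) → ℝ => (∑ i, ((facetPower T i ρ)⁻¹ + ν i))⁻¹)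
      (stratumWeights T ρ J) :=
    ContinuousOn.inv₀ (by fun_prop) fun ν hν => (sum_inv_facetPower_add_pos hρ hν.1.1).ne'
  exact hsum.smul (by fun_prop)

lemma isConnected_core (hρ : T.circumradius < ρ) (h : 0 < radicalPower T ρ) :
    IsConnected (core T ρ) := by
  obtain ⟨j, k, hjk⟩ := exists_pair_ne (Fin (n + 1))
  have hempty : coreStratum T ρ ∅ = core T ρ := by simp [coreStratum]
  exact hempty ▸ isConnected_coreStratum hρ h ⟨j, notMem_empty j, k, notMem_empty k, hjk⟩

end Connected

section Frontier

variable {T}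

lemma closure_core_subset (ρ : ℝ) : closure (core T ρ) ⊆
    {x | 0 ≤ depth T x ∧ ∀ i, depth T x ≤ facetPower T i ρ * bary T i x} := by
  refine closure_minimal (fun x hx => ⟨hx.1.le, hx.2⟩) ?_
  simp only [ofPred_and, ofPred_forall]
  exact (isClosed_le continuous_const (continuous_depth T)).inter (isClosed_iInter fun i =>
    isClosed_le (continuous_depth T) (continuous_const.mul (continuous_bary T i)))

variable [NeZero n]

lemma coreStratum_singleton_subset_sphere (hρ : T.circumradius < ρ) (i : Fin (n + 1)) :
    coreStratum T ρ {i} ⊆ sphere (facetCenter T ρ i) ρ :=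
  fun _ hx => (mem_sphere_facetCenter hρ).2 (hx.2 i rfl)

lemma coreStratum_singleton_subset_frontier (hρ : T.circumradius < ρ) (i : Fin (n + 1)) :
    coreStratum T ρ {i} ⊆ frontier (core T ρ) := by
  refine fun x hx => ⟨subset_closure hx.1, fun hint => ?_⟩
  have hball : x ∈ closure (ball (facetCenter T ρ i) ρ) := by
    rw [closure_ball _ ((circumradius_pos T).trans hρ).ne']
    exact sphere_subset_closedBall (coreStratum_singleton_subset_sphere hρ i hx)
  obtain ⟨y, hy, hyb⟩ := mem_closure_iff.1 hball _ isOpen_interior hint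
  exact ((mem_ball_facetCenter hρ).1 hyb).not_ge ((interior_subset hy).2 i)

lemma frontier_core_subset (hρ : T.circumradius < ρ) :
    frontier (core T ρ) ⊆ (⋃ i, coreStratum T ρ {i}) ∪ range T.points := by
  intro x hx
  obtain ⟨h0, hle⟩ := closure_core_subset ρ hx.1
  rcases h0.lt_or_eq with h0 | h0
  · refine Or.inl (mem_iUnion.2 ?_)
    by_contra! hnot
    refine hx.2 (mem_interior_core h0 fun i => (hle i).lt_of_ne fun heq => hnot i ⟨⟨h0, hle⟩, ?_⟩)
    rintro _ rfl
    exact heq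
  · refine Or.inr (mem_range_points_of_depth_eq_zero T (fun i => ?_) h0.symm)
    exact nonneg_of_mul_nonneg_right (h0.trans_le (hle i)) (facetPower_pos hρ i)

lemma bary_lt_one_of_mem_core (hρ : T.circumradius < ρ) (hx : x ∈ core T ρ) (i : Fin (n + 1)) :
    bary T i x < 1 := by
  obtain ⟨j, hj⟩ := exists_ne i
  rw [← sum_bary T x]
  exact Finset.single_lt_sum hj (Finset.mem_univ i) (Finset.mem_univ j)
    (bary_pos_of_mem_core hρ hx j) fun k _ _ => (bary_pos_of_mem_core hρ hx k).le

end Frontier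

section Vertices

variable {T} [n.AtLeastTwo]

lemma exists_ne_and_ne (i j : Fin (n + 1)) : ∃ k, k ≠ i ∧ k ≠ j :=
  Fin.exists_ne_and_ne_of_two_lt i j (Nat.lt_succ_of_le Nat.AtLeastTwo.prop)

lemma isConnected_coreStratum_singleton (hρ : T.circumradius < ρ) (h : 0 < radicalPower T ρ)
    (i : Fin (n + 1)) : IsConnected (coreStratum T ρ {i}) := by
  obtain ⟨j, hj⟩ := exists_ne i
  obtain ⟨k, hki, hkj⟩ := exists_ne_and_ne i j
  exact isConnected_coreStratum hρ h ⟨j, hj, k, hki, hkj.symm⟩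

variable (T) in
lemma exists_mem_ball_points_bary_eq_zero (j : Fin (n + 1)) {ε : ℝ} (hε : 0 < ε) :
    ∃ q ∈ ball (T.points j) ε, bary T j q ∈ Ioo 0 1 ∧ ∃ l, bary T l q = 0 := by
  obtain ⟨k, hk⟩ := exists_ne j
  obtain ⟨l, hlj, hlk⟩ := exists_ne_and_ne j k
  have hlim : Filter.Tendsto (AffineMap.lineMap (T.points j) (T.points k) : ℝ → E) (𝓝[>] 0)
      (𝓝 (T.points j)) :=
    (AffineMap.lineMap_continuous.tendsto' 0 _ (AffineMap.lineMap_apply_zero _ _)).mono_left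
      nhdsWithin_le_nhds
  obtain ⟨t, ht, ht01⟩ :=
    ((hlim.eventually_mem (ball_mem_nhds _ hε)).and (Ioo_mem_nhdsGT zero_lt_one)).exists
  refine ⟨_, ht, ?_, l, ?_⟩
  · rw [AffineMap.apply_lineMap, bary_points_self, bary_points_of_ne T hk.symm,
      AffineMap.lineMap_apply_ring']
    exact ⟨by linarith [ht01.2], by linarith [ht01.1]⟩
  · rw [AffineMap.apply_lineMap, bary_points_of_ne T hlj, bary_points_of_ne T hlk,
      AffineMap.lineMap_same_apply]

/-- Near a vertex, the convex set where its barycentric coordinate lies strictly between `0` and `1`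
contains no vertices but meets the core and, along an edge, its complement. -/
lemma points_mem_closure_iUnion_coreStratum (hρ : T.circumradius < ρ) {j : Fin (n + 1)}
    (hj : T.points j ∈ closure (core T ρ)) :
    T.points j ∈ closure (⋃ i, coreStratum T ρ {i}) := by
  rw [Metric.mem_closure_iff] at hj ⊢
  intro ε hε
  obtain ⟨y, hy, hyε⟩ := hj ε hε
  obtain ⟨q, hqε, hqj, l, hql⟩ := exists_mem_ball_points_bary_eq_zero T j hε
  set W := ball (T.points j) ε ∩ bary T j ⁻¹' Ioo 0 1
  have hW : Convex ℝ W := (convex_ball _ _).inter ((convex_Ioo 0 1).affine_preimage (bary T j))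
  obtain ⟨p, ⟨hpε, hpj⟩, hp⟩ := nonempty_inter_frontier_of_isPreconnected (A := core T ρ)
    hW.isPreconnected
    ⟨y, ⟨mem_ball'.2 hyε, bary_pos_of_mem_core hρ hy j, bary_lt_one_of_mem_core hρ hy j⟩, hy⟩
    ⟨q, ⟨hqε, hqj⟩, fun hq => (bary_pos_of_mem_core hρ hq l).ne' hql⟩
  refine ⟨p, (frontier_core_subset hρ hp).resolve_right ?_, mem_ball'.1 hpε⟩
  rintro ⟨k, rfl⟩
  rw [mem_preimage, bary_points] at hpj
  split_ifs at hpj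
  · exact hpj.2.false
  · exact hpj.1.false

theorem frontier_core (hρ : T.circumradius < ρ) :
    frontier (core T ρ) = ⋃ i, closure (coreStratum T ρ {i}) := by
  refine Subset.antisymm (fun x hx => ?_) (iUnion_subset fun i =>
    closure_minimal (coreStratum_singleton_subset_frontier hρ i) isClosed_frontier)
  rw [← closure_iUnion_of_finite]
  rcases frontier_core_subset hρ hx with h | ⟨j, rfl⟩
  · exact subset_closure h
  · exact points_mem_closure_iUnion_coreStratum hρ hx.1

end Vertices

end SimplexHull

open SimplexHull in
theorem corollary4p1_general {E : Type*} [NormedAddCommGroup E] [InnerProductSpace ℝ E] {n : ℕ}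
    (hn : 2 ≤ n) (hE : Module.finrank ℝ E = n) (T : Affine.Simplex ℝ E n) :
    ∃ o : ℝ → Fin (n + 1) → E,
      (∀ ρ, T.circumradius < ρ → ∀ i p, IsFacetCenter T i ρ p ↔ p = o ρ i) ∧
      (∀ ρ, 0 < ρ → ρ < fullnessRadius T → ballHull ρ (range T.points) = range T.points) ∧
      (∀ ρ, fullnessRadius T < ρ →
        T.circumradius < ρ ∧
        ballHull ρ (range T.points) = range T.points ∪
          interior (convexHull ℝ (range T.points)) \ ⋃ i, ball (o ρ i) ρ ∧
        IsConnected (interior (convexHull ℝ (range T.points)) \ ⋃ i, ball (o ρ i) ρ) ∧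
        ∃ S : Fin (n + 1) → Set E,
          (∀ i, S i ⊆ sphere (o ρ i) ρ ∧ IsConnected (S i)) ∧
          frontier (interior (convexHull ℝ (range T.points)) \ ⋃ i, ball (o ρ i) ρ) = ⋃ i, S i) ∧
      T.circumradius ≤ fullnessRadius T ∧
      (T.circumradius < fullnessRadius T →
        ∃ O ∈ interior (convexHull ℝ (range T.points)),
          (⋂ i, sphere (o (fullnessRadius T) i) (fullnessRadius T)) = {O} ∧
          ballHull (fullnessRadius T) (range T.points) = range T.points ∪ {O}) ∧
      (fullnessRadius T = T.circumradius →
        ballHull (fullnessRadius T) (range T.points) = range T.points) := by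
  have : Fact (Module.finrank ℝ E = n) := ⟨hE⟩
  have : FiniteDimensional ℝ E := .of_finrank_pos (by omega)
  have : n.AtLeastTwo := ⟨hn⟩
  refine ⟨facetCenter T, fun ρ hρ i p => isFacetCenter_iff hρ,
    fun ρ h0 h => ballHull_eq_range_points_of_lt_fullnessRadius h0 h, fun ρ h => ?_,
    circumradius_le_fullnessRadius T, fun h => ?_,
    fun h => ballHull_eq_range_points T (h ▸ circumradius_pos T) h.le⟩
  · have hρ := (circumradius_le_fullnessRadius T).trans_lt h
    have hpos := radicalPower_pos_of_fullnessRadius_lt h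
    rw [interior_convexHull_sdiff_iUnion_ball hρ]
    exact ⟨hρ, ballHull_eq_union_core hρ, isConnected_core hρ hpos,
      fun i => closure (coreStratum T ρ {i}),
      fun i => ⟨closure_minimal (coreStratum_singleton_subset_sphere hρ i) isClosed_sphere,
        (isConnected_coreStratum_singleton hρ hpos i).closure⟩, frontier_core hρ⟩
  · have hzero := radicalPower_fullnessRadius h
    exact ⟨radicalCenter T (fullnessRadius T),
      (mem_interior_convexHull_iff T).2 (bary_radicalCenter_pos h),
      iInter_sphere_facetCenter h hzero,
      (ballHull_eq_union_core h).trans (by rw [core_eq_singleton h hzero])⟩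

theorem corollary4p1 (T : Affine.Simplex ℝ E3 3) :
    -- `o ρ i` is the centre of `B_i(ρ)`; it exists and is unique for `ρ > r(V)`
    ∃ o : ℝ → Fin 4 → E3,
      (∀ ρ, T.circumradius < ρ → ∀ i p, IsFaceCenter T i ρ p ↔ p = o ρ i) ∧
      (∀ ρ, 0 < ρ → ρ < criticalRadius T → hulloid ρ (vertexSet T) = vertexSet T) ∧
      (∀ ρ, criticalRadius T < ρ →
        T.circumradius < ρ ∧
        hulloid ρ (vertexSet T) = vertexSet T ∪ innerPart T (o ρ) ρ ∧
        IsConnected (innerPart T (o ρ) ρ) ∧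
        ∃ S : Fin 4 → Set E3,
          (∀ i, S i ⊆ sphere (o ρ i) ρ ∧ IsConnected (S i)) ∧
          frontier (innerPart T (o ρ) ρ) = ⋃ i, S i) ∧
      T.circumradius ≤ criticalRadius T ∧
      (T.circumradius < criticalRadius T →
        ∃ O ∈ interior (solid T),
          (⋂ i, sphere (o (criticalRadius T) i) (criticalRadius T)) = {O} ∧
          hulloid (criticalRadius T) (vertexSet T) = vertexSet T ∪ {O}) ∧
      (criticalRadius T = T.circumradius →
        hulloid (criticalRadius T) (vertexSet T) = vertexSet T) := by
  exact corollary4p1_general (by norm_num) finrank_euclideanSpace_fin T
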